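/- **Setting.** Let $\gamma_1,\dots,\gamma_{2n}$ be the Majorana operators on $n$ modes in Jordan–Wigner form, i.e. the $2^n\times 2^n$ matrices $\gamma_{2a-1}=Z^{\otimes (a-1)}\otimes X\otimes I^{\otimes (n-a)}$, $\gamma_{2a}=Z^{\otimes (a-1)}\otimes Y\otimes I^{\otimes (n-a)}$. The correlation matrix of a $2^n\times 2^n$ unitary $U$ is the real $2n\times 2n$ matrix $M_{ab}=2^{-n}\operatorname{tr}(\gamma_a\,U\gamma_bU^\dagger)$; its singular values are $\sigma_1(M)\ge\dots\ge\sigma_{2n}(M)$. A unitary $U$ has Gaussian dimension at least $k$ if there are operators $\eta_1,\dots,\eta_k$ of the form $\eta_a=\sum_b v_{a,b}\gamma_b$ with $v_{a,b}\in\mathbb R$, $\sum_b v_{a,b}^2=1$, with $\operatorname{tr}(\eta_a\eta_b)=0$ for $a\ne b$, such that for each $a\le k$ one has $U\eta_aU^\dagger=\sum_b w_{a,b}\gamma_b$ with $w_{a,b}\in\mathbb R$, $\sum_b w_{a,b}^2=1$. A Gaussian unitary $G$ corresponds to $V\in O(2n)$ if $G\gamma_aG^\dagger=\sum_b V_{ba}\gamma_b$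 for all $a$. The diamond distance of two $d\times d$ unitaries is $$d_\diamond(U,U')=\sup_\rho\big\|(U\otimes 1_d)\rho(U\otimes 1_d)^\dagger-(U'\otimes 1_d)\rho(U'\otimes 1_d)^\dagger\big\|_1,$$ the supremum being over all density matrices $\rho$ on $\mathbb C^d\otimes\mathbb C^d$. **Lemma.** Let $0\le t'\le t\le n$ be integers and $\varepsilon\ge 0$. Let $U$ be an $n$-mode unitary of Gaussian dimension at least $2(n-t)$ whose correlation matrix has a singular value decomposition $M=V_A\Sigma V_B^{\mathsf T}$ with $V_A,V_B\in O(2n)$ and $\Sigma=\operatorname{diag}(\sigma_1(M),\dots,\sigma_{2n}(M))$, and let $G_A,G_B$ be Gaussian unitaries corresponding to $V_A,V_B$, respectively. Suppose that $$\sigma_{2n-2t'}(M)\ \ge\ 1-\frac{\varepsilon^2}{16\,t\cdot 2^t}$$ (a condition that is void if $t'=n$; if $t=0$ the fraction is read as $0$). Then there is a unitary $U'=G_A(1\otimes u')G_B^\dagger$, where $u'$ is a unitary acting on the last $t'$ modes and $1$ is the identity on the first $n-t'$ modes, such that $$d_\diamond(U,U')\le\varepsilon .$$ -/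

import Mathlib

open scoped Matrix Kronecker ENNReal ComplexOrder

noncomputable section

namespace Fermion

/-- Operators on the Hilbert space `(ℂ²)^{⊗ n}` of `n` fermionic modes, written as
`2ⁿ × 2ⁿ` complex matrices whose rows and columns are indexed by bit strings. -/
abbrev Op (n : ℕ) : Type := Matrix (Fin n → Fin 2) (Fin n → Fin 2) ℂ

/-- The Pauli matrix `X`. -/
def pauliX : Matrix (Fin 2) (Fin 2) ℂ := !![0, 1; 1, 0]

/-- The Pauli matrix `Y`. -/
def pauliY : Matrix (Fin 2) (Fin 2) ℂ := !![0, -Complex.I; Complex.I, 0]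

/-- The Pauli matrix `Z`. -/
def pauliZ : Matrix (Fin 2) (Fin 2) ℂ := !![1, 0; 0, -1]

/-- The tensor product `P 0 ⊗ P 1 ⊗ ⋯ ⊗ P (n-1)` of single-mode operators. -/
def tensorString {n : ℕ} (P : Fin n → Matrix (Fin 2) (Fin 2) ℂ) : Op n :=
  Matrix.of fun x y => ∏ i, P i (x i) (y i)

/-- The `2n` Majorana operators on `n` modes (Jordan-Wigner form), numbered from `0`:
`majorana (2a) = Z^{⊗ a} ⊗ X ⊗ I^{⊗ (n-a-1)}` and
`majorana (2a+1) = Z^{⊗ a} ⊗ Y ⊗ I^{⊗ (n-a-1)}`. -/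
def majorana {n : ℕ} (j : Fin (2 * n)) : Op n :=
  tensorString fun i =>
    if (i : ℕ) < (j : ℕ) / 2 then pauliZ
    else if (i : ℕ) = (j : ℕ) / 2 then (if (j : ℕ) % 2 = 0 then pauliX else pauliY)
    else 1

/-- The real linear combination `∑_b v_b γ_b` of the Majorana operators. -/
def majoranaComb {n : ℕ} (v : Fin (2 * n) → ℝ) : Op n :=
  ∑ b, (v b : ℂ) • majorana b

theorem majorana_conjTranspose {n : ℕ} (j : Fin (2 * n)) :
    (majorana j)ᴴ = (majorana j : Op n) := by
  have hX : ∀ a b, star (pauliX b a) = pauliX a b := by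
    intro a b; fin_cases a <;> fin_cases b <;> simp [pauliX]
  have hY : ∀ a b, star (pauliY b a) = pauliY a b := by
    intro a b; fin_cases a <;> fin_cases b <;> simp [pauliY]
  have hZ : ∀ a b, star (pauliZ b a) = pauliZ a b := by
    intro a b; fin_cases a <;> fin_cases b <;> simp [pauliZ]
  have hI : ∀ a b, star ((1 : Matrix (Fin 2) (Fin 2) ℂ) b a) = (1 : Matrix _ _ ℂ) a b := by
    intro a b; fin_cases a <;> fin_cases b <;> simp
  ext x y
  simp only [majorana, tensorString, Matrix.conjTranspose_apply, Matrix.of_apply, star_prod]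
  refine Finset.prod_congr rfl fun i _ => ?_
  split_ifs
  · exact hZ _ _
  · exact hX _ _
  · exact hY _ _
  · exact hI _ _

/-- The correlation matrix `M_{ab} = 2^{-n} tr(γ_a · U γ_b U†)` of an `n`-mode operator. The trace
is a real number (see `correlationMatrix_ofReal`), so that `M` is a real `2n × 2n` matrix. -/
def correlationMatrix {n : ℕ} (U : Op n) : Matrix (Fin (2 * n)) (Fin (2 * n)) ℝ :=
  Matrix.of fun a b => ((majorana a * (U * majorana b * Uᴴ)).trace).re / 2 ^ n

theorem correlationMatrix_ofReal {n : ℕ} (U : Op n) (a b : Fin (2 * n)) :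
    ((correlationMatrix U a b : ℝ) : ℂ) =
      (majorana a * (U * majorana b * Uᴴ)).trace / 2 ^ n := by
  have h : star (majorana a * (U * majorana b * Uᴴ)).trace
      = (majorana a * (U * majorana b * Uᴴ)).trace := by
    rw [← Matrix.trace_conjTranspose]
    simp only [Matrix.conjTranspose_mul, Matrix.conjTranspose_conjTranspose,
      majorana_conjTranspose]
    rw [Matrix.trace_mul_comm, Matrix.mul_assoc]
  have h' := Complex.conj_eq_iff_re.mp h
  simp only [correlationMatrix, Matrix.of_apply]
  push_cast
  rw [h']

/-- `U` has Gaussian dimension at least `k`: there are `k` pairwise trace-orthogonal rotated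
Majorana operators `η_a` (combinations of the `γ_b` with real coefficient vectors of norm one) each
of which `U` conjugates into a rotated Majorana operator. -/
def GaussianDimensionAtLeast {n : ℕ} (U : Op n) (k : ℕ) : Prop :=
  ∃ v w : Fin k → Fin (2 * n) → ℝ,
    (∀ a, ∑ b, v a b ^ 2 = 1) ∧
    (∀ a b, a ≠ b → (majoranaComb (v a) * majoranaComb (v b)).trace = 0) ∧
    (∀ a, ∑ b, w a b ^ 2 = 1) ∧
    (∀ a, U * majoranaComb (v a) * Uᴴ = majoranaComb (w a))

/-- `G` is a Gaussian unitary corresponding to the orthogonal matrix `V ∈ O(2n)`: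
`G γ_a G† = ∑_b V_{ba} γ_b` for all `a`. -/
def IsGaussianUnitaryOf {n : ℕ} (G : Op n) (V : Matrix (Fin (2 * n)) (Fin (2 * n)) ℝ) : Prop :=
  G ∈ Matrix.unitaryGroup (Fin n → Fin 2) ℂ ∧
  V ∈ Matrix.orthogonalGroup (Fin (2 * n)) ℝ ∧
  ∀ a, G * majorana a * Gᴴ = majoranaComb fun b => V b a

/-- The singular values `σ_0 ≥ σ_1 ≥ ⋯` of a square matrix, in decreasing order, counted with
multiplicity and numbered from `0`. -/
def singularValue {𝕜 m : Type*} [RCLike 𝕜] [Fintype m] [DecidableEq m]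
    (A : Matrix m m 𝕜) (k : ℕ) : ℝ :=
  (Matrix.toEuclideanLin A).singularValues k

/-- The trace norm `‖A‖₁`, the sum of the singular values of `A`. -/
def traceNorm {m : Type*} [Fintype m] [DecidableEq m] (A : Matrix m m ℂ) : ℝ :=
  ∑ k ∈ Finset.range (Fintype.card m), singularValue A k

/-- `ρ` is a density matrix. -/
def IsDensityMatrix {m : Type*} [Fintype m] (ρ : Matrix m m ℂ) : Prop :=
  ρ.PosSemidef ∧ ρ.trace = 1

/-- The output `(U ⊗ 1) ρ (U ⊗ 1)†` of the channel of `U`, extended by a reference system of the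
same dimension, on the input `ρ`. -/
def extendedChannel {m : Type*} [Fintype m] [DecidableEq m] (U : Matrix m m ℂ)
    (ρ : Matrix (m × m) (m × m) ℂ) : Matrix (m × m) (m × m) ℂ :=
  (U ⊗ₖ (1 : Matrix m m ℂ)) * ρ * (U ⊗ₖ (1 : Matrix m m ℂ))ᴴ

/-- The diamond distance between the unitary channels of `U` and `V`, the supremum over all density
matrices `ρ` on the system and a reference system of
`‖(U ⊗ 1) ρ (U ⊗ 1)† - (V ⊗ 1) ρ (V ⊗ 1)†‖₁`. The supremum is taken in `[0, ∞]`. -/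
def diamondDistance {m : Type*} [Fintype m] [DecidableEq m] (U V : Matrix m m ℂ) : ℝ≥0∞ :=
  ⨆ (ρ : Matrix (m × m) (m × m) ℂ) (_ : IsDensityMatrix ρ),
    ENNReal.ofReal (traceNorm (extendedChannel U ρ - extendedChannel V ρ))

/-- The last `s` bits of a string of `n` bits. -/
def lastBits {n s : ℕ} (h : s ≤ n) (x : Fin n → Fin 2) : Fin s → Fin 2 :=
  fun j => x ⟨n - s + j, by omega⟩

/-- The operator `1 ⊗ u` on `n` modes, where `u` acts on the last `s` modes and `1` is the identity
on the first `n - s` modes. -/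
def onLastModes {n s : ℕ} (h : s ≤ n) (u : Op s) : Op n :=
  Matrix.of fun x y =>
    if ∀ i : Fin n, (i : ℕ) < n - s → x i = y i then u (lastBits h x) (lastBits h y) else 0

end Fermion

end

noncomputable section

namespace Fermion

open scoped Matrix.Norms.L2Operator InnerProductSpace

/-! ### Nearby unitaries via polar decomposition -/

section Polar

/-! Put `W = G_A† U G_B`. In the rotated frame the correlations are diagonal
(`trace_majorana_mul_conj_of_svd`), so the squared Frobenius norm of `[W, γ_j]` is `2 · 2^n (1 -
σ_j)` (`normSqF_commutator`): a singular value near `1` means that `W` nearly commutes with `γ_j`.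
Gaussian dimension forces the first `2(n-t)` singular values to be exactly `1`
(`singular_value_eq_one_of_isometric`), so `W` commutes with those Majoranas and, by
`exists_eq_onLastModes`, acts on the last `t` modes only.

Averaging `W` over conjugation by the first `2(n-t')` Majoranas yields `Y` in their commutant, and
orthogonality of odd and even parts bounds the Frobenius error by the commutators
(`exists_commute_majorana_normSqF_sub_le`). Since `W - Y` lives on `t` modes, its operator norm is
governed by a Frobenius norm smaller by `2^(n-t)` when squared (`norm_le_of_normSqF_le`); this is
why the hypothesis involves `2^t` and not `2^n`. The result is `‖W - Y‖ ≤ ε/4`.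

The polar part `Q` of `Y` stays in the commutant and costs at most another `ε/4`
(`exists_unitary_commute_norm_sub_le`), so `Q = 1 ⊗ u'`. Finally the diamond distance is at most
twice the operator norm distance (`diamondDistance_le`), giving `2 · ε/2 = ε`. -/

theorem cfc_mul_self_mul_cfc {A : Type*} [CStarAlgebra A] {h : A} (hsa : IsSelfAdjoint h)
    {f : ℝ → ℝ} (hf : ContinuousOn f (spectrum ℝ h)) :
    cfc f h * h * cfc f h = cfc (fun y => f y * y * f y) h := by
  have hcid : ContinuousOn (fun y : ℝ => y) (spectrum ℝ h) := continuousOn_id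
  have hf' : ContinuousOn (fun y => f y * y) (spectrum ℝ h) := hf.mul hcid
  rw [cfc_mul (fun y => f y * y) f h hf' hf, cfc_mul f (fun y => y) h hf hcid, cfc_id' ℝ h]

/-- An element of a C⋆-algebra at distance at most `r < 1` from a unitary is at distance at most `r`
from a unitary in the C⋆-algebra that it generates. -/
theorem exists_unitary_norm_sub_le {A : Type*} [CStarAlgebra A] [Nontrivial A] {x w : A} {r : ℝ}
    (hw : w ∈ unitary A) (hxw : ‖x - w‖ ≤ r) (hr : r < 1) :
    ∃ q ∈ unitary A, ‖x - q‖ ≤ r ∧ ∀ c, Commute x c → Commute (star x) c → Commute q c := by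
  have hr0 : 0 ≤ r := (norm_nonneg _).trans hxw
  have hw1 : ‖w‖ = 1 := CStarRing.norm_of_mem_unitary hw
  have hws1 : ‖star w‖ = 1 := by rw [norm_star, hw1]
  have hx : IsUnit x := by
    have h1 : IsUnit (1 - star w * (w - x)) := by
      apply isUnit_one_sub_of_norm_lt_one
      calc ‖star w * (w - x)‖ ≤ ‖star w‖ * ‖w - x‖ := norm_mul_le _ _
        _ < 1 := by rw [hws1, one_mul, norm_sub_rev]; linarith
    have h2 : x = w * (1 - star w * (w - x)) := by
      rw [mul_sub, ← mul_assoc, Unitary.mul_star_self_of_mem hw]; simp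
    rw [h2]
    exact (Unitary.toUnits ⟨w, hw⟩).isUnit.mul h1
  obtain ⟨u, rfl⟩ := hx
  -- The bounds `‖x⁻¹‖ ≤ 1/(1-r)` and `‖x‖ ≤ 1+r` confine the spectrum of `x* x` to `[(1-r)²,
  -- (1+r)²]`.
  have hinv : ‖(↑u⁻¹ : A)‖ * (1 - r) ≤ 1 := by
    have h1 : (↑u⁻¹ : A) = star w + ↑u⁻¹ * (w - u) * star w := by
      rw [mul_sub, sub_mul, mul_assoc, Unitary.mul_star_self_of_mem hw]; simp
    have h2 : ‖(↑u⁻¹ : A)‖ ≤ 1 + ‖(↑u⁻¹ : A)‖ * r := by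
      calc ‖(↑u⁻¹ : A)‖ = ‖star w + ↑u⁻¹ * (w - u) * star w‖ := by rw [← h1]
        _ ≤ ‖star w‖ + ‖(↑u⁻¹ : A)‖ * ‖w - u‖ * ‖star w‖ :=
            (norm_add_le _ _).trans (by gcongr; exact norm_mul₃_le)
        _ ≤ _ := by
            rw [hws1, mul_one, norm_sub_rev]; gcongr
    linarith
  have hnorm : ‖(u : A)‖ ≤ 1 + r := by
    calc ‖(u : A)‖ = ‖(u - w) + w‖ := by simp
      _ ≤ r + 1 := (norm_add_le _ _).trans (by rw [hw1]; gcongr)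
      _ = _ := add_comm _ _
  set h : Aˣ := star u * u with hh
  have hhv : (h : A) = star (u : A) * u := by simp [hh]
  have hsa : IsSelfAdjoint (h : A) := by rw [hhv]; exact IsSelfAdjoint.star_mul_self _
  have hspec : ∀ y ∈ spectrum ℝ (h : A), 0 < y ∧ |√y - 1| ≤ r := by
    intro y hy
    have hy0 : 0 ≤ y := by
      rw [hhv] at hy
      exact spectrum_star_mul_self_nonneg y hy
    have hyne : y ≠ 0 := spectrum.ne_zero_of_mem_of_unit hy
    have hypos : 0 < y := lt_of_le_of_ne hy0 hyne.symm
    have h1 : y ≤ (1 + r) ^ 2 := by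
      have := spectrum.norm_le_norm_of_mem hy
      rw [hhv, CStarRing.norm_star_mul_self, Real.norm_of_nonneg hy0] at this
      nlinarith [norm_nonneg (u : A)]
    have h2 : y⁻¹ * (1 - r) ^ 2 ≤ 1 := by
      have hyi : y⁻¹ ∈ spectrum ℝ (↑h⁻¹ : A) := by
        have := (spectrum.inv_mem_iff (R := ℝ) (r := Units.mk0 y hyne) (a := h)).1 (by simpa using hy)
        simpa using this
      have := spectrum.norm_le_norm_of_mem hyi
      have h3 : (↑h⁻¹ : A) = ↑u⁻¹ * star (↑u⁻¹ : A) := by simp [hh]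
      rw [h3, CStarRing.norm_self_mul_star, Real.norm_of_nonneg (by positivity)] at this
      have h4 : 0 ≤ ‖(↑u⁻¹ : A)‖ * (1 - r) := mul_nonneg (norm_nonneg _) (by linarith)
      nlinarith [sq_nonneg (1 - r)]
    have h3 : (1 - r) ^ 2 ≤ y := by
      rwa [inv_mul_le_iff₀ hypos, mul_one] at h2
    refine ⟨hypos, abs_le.2 ⟨?_, ?_⟩⟩
    · have := Real.le_sqrt_of_sq_le h3
      linarith
    · have := (Real.sqrt_le_left (by linarith)).2 h1
      linarith
  have hc1 : ContinuousOn (fun y : ℝ => (√y)⁻¹) (spectrum ℝ (h : A)) :=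
    Real.continuous_sqrt.continuousOn.inv₀ fun y hy => (Real.sqrt_pos.2 (hspec y hy).1).ne'
  -- `g = (x* x)^(-1/2)`, so that `x g` is the unitary factor of the polar decomposition.
  set g : A := cfc (fun y : ℝ => (√y)⁻¹) (h : A) with hg
  have hgsa : star g = g := (cfc_predicate (R := ℝ) (fun y : ℝ => (√y)⁻¹) (h : A)).star_eq
  have hghg : g * (h : A) * g = 1 := by
    rw [hg, cfc_mul_self_mul_cfc hsa hc1, ← cfc_one ℝ (h : A)]
    refine cfc_congr fun y hy => ?_
    have := Real.sqrt_pos.2 (hspec y hy).1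
    have h2 := Real.mul_self_sqrt (hspec y hy).1.le
    simp only [Pi.one_apply]
    field_simp
    linarith
  have hgu : IsUnit g :=
    isUnit_iff_exists_and_exists.2 ⟨⟨h * g, by rw [← mul_assoc, hghg]⟩, ⟨g * h, hghg⟩⟩
  have hqq : star ((u : A) * g) * (u * g) = 1 := by
    rw [star_mul, hgsa, mul_assoc, ← mul_assoc (star (u : A)), ← hhv, ← mul_assoc, hghg]
  refine ⟨u * g, ?_, ?_, ?_⟩
  -- An isometry need not be unitary in a general C⋆-algebra; invertibility of `x` and `g` supplies
  -- the other identity.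
  · refine Unitary.mem_iff.2 ⟨hqq, ?_⟩
    obtain ⟨v, hv⟩ := u.isUnit.mul hgu
    rw [← hv] at hqq ⊢
    rw [left_inv_eq_right_inv hqq v.mul_inv, Units.mul_inv]
  · have hc2 : ContinuousOn (fun y : ℝ => 1 - (√y)⁻¹) (spectrum ℝ (h : A)) :=
      continuousOn_const.sub hc1
    have h1g : 1 - g = cfc (fun y : ℝ => 1 - (√y)⁻¹) (h : A) := by
      rw [cfc_sub (fun _ : ℝ => (1 : ℝ)) _ _ continuousOn_const hc1, cfc_const_one ℝ (h : A)]
    have h2 : ‖(u : A) - u * g‖ * ‖(u : A) - u * g‖ ≤ r * r := by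
      have h3 : (u : A) - u * g = u * (1 - g) := by rw [mul_sub, mul_one]
      have h4 : star (1 - g) = 1 - g := by rw [star_sub, star_one, hgsa]
      have h5 : (1 - g) * h * (1 - g) =
          cfc (fun y : ℝ => (1 - (√y)⁻¹) * y * (1 - (√y)⁻¹)) (h : A) := by
        rw [h1g, cfc_mul_self_mul_cfc hsa hc2]
      rw [← CStarRing.norm_star_mul_self, h3, star_mul, h4, mul_assoc, ← mul_assoc (star (u : A)),
        ← hhv, ← mul_assoc, h5]
      refine norm_cfc_le (by positivity) fun y hy => ?_
      obtain ⟨hy0, hy1⟩ := hspec y hy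
      have := Real.sqrt_pos.2 hy0
      have h6 : (1 - (√y)⁻¹) * y * (1 - (√y)⁻¹) = (√y - 1) ^ 2 := by
        nth_rw 2 [← Real.mul_self_sqrt hy0.le]
        field_simp
      rw [h6, Real.norm_of_nonneg (sq_nonneg _), ← sq_abs, ← sq]
      gcongr
    exact le_of_sq_le_sq (by simpa only [sq] using h2) hr0
  · intro c hc hc'
    have : Commute (h : A) c := by rw [hhv]; exact hc'.mul_left hc
    exact hc.mul_left (hsa.commute_cfc this _)

end Polar

/-! ### Trace norm, diamond distance and operator norm -/

section TraceNorm

variable {m : Type*} [Fintype m] [DecidableEq m]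

/-- The `f i` are eigenvectors of `A* A` and the `g i` their normalized images. Only Bessel's
inequality is asked of them, so `g i = 0` is allowed where the singular value vanishes, which is
what the convention `0⁻¹ = 0` produces. -/
theorem exists_singular_vectors (A : Matrix m m ℂ) :
    ∃ (f g : Fin (Fintype.card m) → EuclideanSpace ℂ m),
      (∀ x, ∑ i, ‖⟪f i, x⟫_ℂ‖ ^ 2 ≤ ‖x‖ ^ 2) ∧ (∀ x, ∑ i, ‖⟪g i, x⟫_ℂ‖ ^ 2 ≤ ‖x‖ ^ 2) ∧
      ∀ i : Fin (Fintype.card m), (singularValue A (i : ℕ) : ℂ) = ⟪g i, Matrix.toEuclideanLin A (f i)⟫_ℂ := by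
  have hN : Module.finrank ℂ (EuclideanSpace ℂ m) = Fintype.card m := finrank_euclideanSpace
  set T := Matrix.toEuclideanLin A with hT
  set f := T.isSymmetric_adjoint_comp_self.eigenvectorBasis hN with hf
  have hs : ∀ i : Fin (Fintype.card m), singularValue A i = T.singularValues i := fun i => rfl
  have hin : ∀ i j, ⟪T (f i), T (f j)⟫_ℂ = if i = j then (T.singularValues i : ℂ) ^ 2 else 0 := by
    intro i j
    have h1 := T.isSymmetric_adjoint_comp_self.apply_eigenvectorBasis hN j
    rw [← T.sq_singularValues_fin hN] at h1
    rw [← LinearMap.adjoint_inner_right]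
    change ⟪f i, (T.adjoint ∘ₗ T) (f j)⟫_ℂ = _
    rw [h1, inner_smul_right, orthonormal_iff_ite.1 f.orthonormal]
    split_ifs with h <;> simp [h]
  refine ⟨f, fun i => ((T.singularValues i : ℂ))⁻¹ • T (f i), fun x => ?_, fun x => ?_, fun i => ?_⟩
  · exact (f.orthonormal).sum_inner_products_le x
  · classical
    set g := fun i : Fin (Fintype.card m) => ((T.singularValues i : ℂ))⁻¹ • T (f i) with hg
    have ho : Orthonormal ℂ (fun i : {i : Fin (Fintype.card m) // T.singularValues i ≠ 0} => g i) := by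
      rw [orthonormal_iff_ite]
      rintro ⟨i, hi⟩ ⟨j, hj⟩
      simp only [hg, inner_smul_left, inner_smul_right, hin, Subtype.mk.injEq]
      split_ifs with h
      · subst h
        have : (T.singularValues i : ℂ) ≠ 0 := by exact_mod_cast hi
        simp
        field_simp
      · simp
    have h1 := ho.sum_inner_products_le x (s := Finset.univ)
    refine le_trans (le_of_eq ?_) h1
    rw [← Fintype.sum_subtype_add_sum_subtype (fun i : Fin (Fintype.card m) =>
      T.singularValues i ≠ 0) fun i => ‖⟪g i, x⟫_ℂ‖ ^ 2, add_eq_left]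
    refine Finset.sum_eq_zero fun i _ => ?_
    simp [hg, not_not.1 i.2]
  · rw [hs, inner_smul_left, hin]
    by_cases h : (T.singularValues i : ℂ) = 0
    · simp [h]
    · simp
      field_simp

/-- Each singular value is a matrix element between singular vectors; Cauchy–Schwarz over these
vectors, then Bessel, bounds each rank-one term. This replaces the triangle inequality for the trace
norm. -/
theorem traceNorm_sum_vecMulVec_le {κ : Type*} [Fintype κ] (c d : κ → m → ℂ) :
    traceNorm (∑ k, Matrix.vecMulVec (c k) (star (d k))) ≤
      ∑ k, ‖WithLp.toLp 2 (c k)‖ * ‖WithLp.toLp 2 (d k)‖ := by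
  obtain ⟨f, g, hf, hg, h⟩ := exists_singular_vectors (∑ k, Matrix.vecMulVec (c k) (star (d k)))
  have h1 : ∀ i : Fin (Fintype.card m), singularValue (∑ k, Matrix.vecMulVec (c k) (star (d k))) i =
      (∑ k, ⟪WithLp.toLp 2 (d k), f i⟫_ℂ * ⟪g i, WithLp.toLp 2 (c k)⟫_ℂ).re := by
    intro i
    rw [← Complex.ofReal_re (singularValue _ i), h i]
    congr 1
    rw [map_sum, LinearMap.sum_apply, inner_sum]
    refine Finset.sum_congr rfl fun k _ => ?_
    rw [← inner_smul_right]
    congr 1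
    ext j
    simp [Matrix.toLpLin_apply, Matrix.vecMulVec_mulVec, EuclideanSpace.inner_eq_star_dotProduct,
      dotProduct_comm, mul_comm]
  rw [traceNorm, Finset.sum_range]
  calc ∑ i : Fin (Fintype.card m), singularValue (∑ k, Matrix.vecMulVec (c k) (star (d k))) i
      ≤ ∑ i, ∑ k, ‖⟪f i, WithLp.toLp 2 (d k)⟫_ℂ‖ * ‖⟪g i, WithLp.toLp 2 (c k)⟫_ℂ‖ := by
        refine Finset.sum_le_sum fun i _ => ?_
        rw [h1]
        refine (Complex.re_le_norm _).trans ((norm_sum_le _ _).trans (Finset.sum_le_sum fun k _ => ?_))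
        rw [norm_mul, norm_inner_symm]
    _ = ∑ k, ∑ i, ‖⟪f i, WithLp.toLp 2 (d k)⟫_ℂ‖ * ‖⟪g i, WithLp.toLp 2 (c k)⟫_ℂ‖ :=
        Finset.sum_comm
    _ ≤ _ := by
        refine Finset.sum_le_sum fun k _ => ?_
        refine (Real.sum_mul_le_sqrt_mul_sqrt _ _ _).trans ?_
        rw [mul_comm]
        gcongr
        · exact (Real.sqrt_le_left (norm_nonneg _)).2 (hg _)
        · exact (Real.sqrt_le_left (norm_nonneg _)).2 (hf _)

/-- Telescoping as `(K - L) ρ K† + L ρ (K - L)†` and splitting `ρ` into rank-one terms of total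
weight `1` gives one factor `‖K - L‖` per summand. -/
theorem traceNorm_conj_sub_conj_le {K L ρ : Matrix m m ℂ} (hK : ‖K‖ ≤ 1) (hL : ‖L‖ ≤ 1)
    (hρ : IsDensityMatrix ρ) : traceNorm (K * ρ * Kᴴ - L * ρ * Lᴴ) ≤ 2 * ‖K - L‖ := by
  obtain ⟨r, b, hb⟩ := Matrix.posSemidef_iff_eq_sum_vecMulVec.1 hρ.1
  have htr : ∑ k, ‖WithLp.toLp 2 (b k)‖ ^ 2 = 1 := by
    have h := hρ.2
    rw [hb, Matrix.trace_sum] at h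
    have h2 := congrArg Complex.re h
    rw [Complex.re_sum] at h2
    simp only [Complex.one_re] at h2
    rw [← h2]
    refine Finset.sum_congr rfl fun k _ => ?_
    rw [EuclideanSpace.norm_sq_eq, Matrix.trace_vecMulVec]
    simp only [dotProduct, Pi.star_apply, RCLike.star_def, Complex.mul_conj,
      Complex.normSq_eq_norm_sq, Complex.re_sum, Complex.ofReal_re]
  have hdec : K * ρ * Kᴴ - L * ρ * Lᴴ =
      ∑ k : Fin r ⊕ Fin r, Matrix.vecMulVec
        (Sum.elim (fun k => (K - L) *ᵥ b k) (fun k => L *ᵥ b k) k)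
        (star (Sum.elim (fun k => K *ᵥ b k) (fun k => (K - L) *ᵥ b k) k)) := by
    have h1 : K * ρ * Kᴴ - L * ρ * Lᴴ = (K - L) * ρ * Kᴴ + L * ρ * (K - L)ᴴ := by
      rw [Matrix.conjTranspose_sub]; noncomm_ring
    rw [h1, Fintype.sum_sum_type, hb]
    simp only [Matrix.mul_sum, Matrix.sum_mul, Sum.elim_inl, Sum.elim_inr, Matrix.star_mulVec,
      Matrix.mul_vecMulVec, Matrix.vecMulVec_mul]
  have hmv : ∀ (M : Matrix m m ℂ) v, ‖WithLp.toLp 2 (M *ᵥ v)‖ ≤ ‖M‖ * ‖WithLp.toLp 2 v‖ :=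
    fun M v => Matrix.l2_opNorm_mulVec M (WithLp.toLp 2 v)
  rw [hdec]
  refine (traceNorm_sum_vecMulVec_le _ _).trans ?_
  rw [Fintype.sum_sum_type, ← Finset.sum_add_distrib]
  calc _ ≤ ∑ k, 2 * ‖K - L‖ * ‖WithLp.toLp 2 (b k)‖ ^ 2 := by
        refine Finset.sum_le_sum fun k _ => ?_
        simp only [Sum.elim_inl, Sum.elim_inr]
        have h1 := hmv (K - L) (b k)
        have h2 := (hmv K (b k)).trans (mul_le_of_le_one_left (norm_nonneg _) hK)
        have h3 := (hmv L (b k)).trans (mul_le_of_le_one_left (norm_nonneg _) hL)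
        have h4 := mul_le_mul h1 h2 (norm_nonneg _) (by positivity)
        have h5 := mul_le_mul h3 h1 (norm_nonneg _) (by positivity)
        linarith
    _ = _ := by rw [← Finset.mul_sum, htr, mul_one]

theorem norm_starAlgHom_matrix_le {l : Type*} [Fintype l] [DecidableEq l]
    (φ : Matrix m m ℂ →⋆ₐ[ℂ] Matrix l l ℂ) (M : Matrix m m ℂ) : ‖φ M‖ ≤ ‖M‖ :=
  NonUnitalStarAlgHom.norm_apply_le φ M

/-- Tensoring with the identity on the right. -/
def kroneckerOneHom (l : Type*) [Fintype l] [DecidableEq l] :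
    Matrix m m ℂ →⋆ₐ[ℂ] Matrix (m × l) (m × l) ℂ where
  toFun M := M ⊗ₖ (1 : Matrix l l ℂ)
  map_one' := Matrix.one_kronecker_one
  map_mul' M N := by rw [← Matrix.mul_kronecker_mul, Matrix.one_mul]
  map_zero' := Matrix.zero_kronecker _
  map_add' M N := Matrix.add_kronecker _ _ _
  commutes' c := by
    rw [Algebra.algebraMap_eq_smul_one, Algebra.algebraMap_eq_smul_one, Matrix.smul_kronecker,
      Matrix.one_kronecker_one]
  map_star' M := by
    rw [Matrix.star_eq_conjTranspose, Matrix.star_eq_conjTranspose, Matrix.conjTranspose_kronecker,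
      Matrix.conjTranspose_one]

theorem norm_le_one_of_mem_unitaryGroup {U : Matrix m m ℂ} (hU : U ∈ Matrix.unitaryGroup m ℂ) :
    ‖U‖ ≤ 1 := by
  -- Over an empty index type the unitary `1 = 0` has norm `0`, hence an inequality only.
  cases subsingleton_or_nontrivial (Matrix m m ℂ)
  · rw [Subsingleton.elim U 0, norm_zero]; exact zero_le_one
  · exact (CStarRing.norm_of_mem_unitary hU).le

theorem diamondDistance_le {U V : Matrix m m ℂ} (hU : U ∈ Matrix.unitaryGroup m ℂ)
    (hV : V ∈ Matrix.unitaryGroup m ℂ) :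
    diamondDistance U V ≤ ENNReal.ofReal (2 * ‖U - V‖) := by
  refine iSup₂_le fun ρ hρ => ENNReal.ofReal_le_ofReal ?_
  have h : ∀ M : Matrix m m ℂ, ‖M ⊗ₖ (1 : Matrix m m ℂ)‖ ≤ ‖M‖ :=
    norm_starAlgHom_matrix_le (kroneckerOneHom m)
  refine (traceNorm_conj_sub_conj_le ((h U).trans (norm_le_one_of_mem_unitaryGroup hU))
    ((h V).trans (norm_le_one_of_mem_unitaryGroup hV)) hρ).trans ?_
  have h2 := map_sub (kroneckerOneHom (m := m) m) U V
  change (U - V) ⊗ₖ 1 = U ⊗ₖ 1 - V ⊗ₖ 1 at h2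
  rw [← h2]
  gcongr
  exact h _

/-- The operator norm is at most the Frobenius norm. -/
theorem sq_norm_le_trace (M : Matrix m m ℂ) : ‖M‖ ^ 2 ≤ (Mᴴ * M).trace.re := by
  have htr : (Mᴴ * M).trace.re = ∑ i, ∑ j, ‖M i j‖ ^ 2 := by
    rw [Finset.sum_comm]
    simp only [Matrix.trace, Matrix.diag_apply, Matrix.mul_apply, Matrix.conjTranspose_apply,
      RCLike.star_def, ← Complex.normSq_eq_conj_mul_self, Complex.normSq_eq_norm_sq,
      Complex.re_sum, Complex.ofReal_re]
  have h0 : 0 ≤ ∑ i, ∑ j, ‖M i j‖ ^ 2 := by positivity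
  rw [htr, ← Real.le_sqrt (norm_nonneg _) h0, Matrix.cstar_norm_def]
  refine ContinuousLinearMap.opNorm_le_bound _ (Real.sqrt_nonneg _) fun x => ?_
  rw [← Real.sqrt_sq (norm_nonneg x), ← Real.sqrt_mul h0, EuclideanSpace.norm_eq]
  refine Real.sqrt_le_sqrt ?_
  rw [Finset.sum_mul]
  refine Finset.sum_le_sum fun i _ => ?_
  have h1 := norm_inner_le_norm (𝕜 := ℂ) (WithLp.toLp 2 (star (M i)) : EuclideanSpace ℂ m) x
  have h2 : ⟪(WithLp.toLp 2 (star (M i)) : EuclideanSpace ℂ m), x⟫_ℂ =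
      Matrix.toEuclideanCLM (n := m) (𝕜 := ℂ) M x i := by
    rw [Matrix.ofLp_toEuclideanCLM, EuclideanSpace.inner_eq_star_dotProduct, Matrix.mulVec,
      dotProduct_comm]
    simp
  have h3 : ∑ j, ‖M i j‖ ^ 2 = ‖(WithLp.toLp 2 (star (M i)) : EuclideanSpace ℂ m)‖ ^ 2 := by
    rw [EuclideanSpace.norm_sq_eq]; simp
  rw [h3, ← h2, ← mul_pow]
  gcongr

end TraceNorm

/-! ### Algebra of Pauli strings -/

section TensorString

variable {n : ℕ}

theorem tensorString_mul (P Q : Fin n → Matrix (Fin 2) (Fin 2) ℂ) :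
    tensorString P * tensorString Q = tensorString fun i => P i * Q i := by
  ext x y
  simp only [tensorString, Matrix.mul_apply, Matrix.of_apply, ← Finset.prod_mul_distrib]
  rw [Finset.prod_univ_sum, Fintype.piFinset_univ]

theorem tensorString_one : tensorString (fun _ : Fin n => 1) = 1 := by
  ext x y
  simp only [tensorString, Matrix.of_apply, Matrix.one_apply, Finset.prod_ite_zero,
    Finset.prod_const_one, Finset.mem_univ, true_implies, funext_iff]

theorem tensorString_smul (c : Fin n → ℂ) (P : Fin n → Matrix (Fin 2) (Fin 2) ℂ) :
    tensorString (fun i => c i • P i) = (∏ i, c i) • tensorString P := by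
  ext x y
  simp [tensorString, Finset.prod_mul_distrib]

theorem pauliX_mul_self : pauliX * pauliX = 1 := by
  ext i j; fin_cases i <;> fin_cases j <;> simp [pauliX, Matrix.mul_apply]

theorem pauliY_mul_self : pauliY * pauliY = 1 := by
  ext i j; fin_cases i <;> fin_cases j <;> simp [pauliY, Matrix.mul_apply]

theorem pauliZ_mul_self : pauliZ * pauliZ = 1 := by
  ext i j; fin_cases i <;> fin_cases j <;> simp [pauliZ, Matrix.mul_apply]

theorem pauliX_mul_pauliY : pauliX * pauliY = Complex.I • pauliZ := by
  ext i j; fin_cases i <;> fin_cases j <;> simp [pauliX, pauliY, pauliZ, Matrix.mul_apply]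

theorem pauliX_mul_pauliY_eq_neg : pauliX * pauliY = (-1 : ℂ) • (pauliY * pauliX) := by
  ext i j; fin_cases i <;> fin_cases j <;> simp [pauliX, pauliY, Matrix.mul_apply]

theorem pauliX_mul_pauliZ : pauliX * pauliZ = (-1 : ℂ) • (pauliZ * pauliX) := by
  ext i j; fin_cases i <;> fin_cases j <;> simp [pauliX, pauliZ, Matrix.mul_apply]

theorem pauliY_mul_pauliZ : pauliY * pauliZ = (-1 : ℂ) • (pauliZ * pauliY) := by
  ext i j; fin_cases i <;> fin_cases j <;> simp [pauliY, pauliZ, Matrix.mul_apply]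

end TensorString

/-! ### Anticommutation and trace orthogonality of the Majoranas -/

section Majorana

variable {n : ℕ}

theorem majorana_mul_self (j : Fin (2 * n)) : majorana j * majorana j = (1 : Op n) := by
  rw [majorana, tensorString_mul, ← tensorString_one]
  congr 1
  funext i
  split_ifs
  exacts [pauliZ_mul_self, pauliX_mul_self, pauliY_mul_self, one_mul 1]

theorem majorana_mul_of_lt {i j : Fin (2 * n)} (h : i < j) :
    majorana i * majorana j = -(majorana j * majorana i : Op n) := by
  have hi : (i : ℕ) / 2 < n := by omega
  rw [majorana, majorana, tensorString_mul, tensorString_mul]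
  -- The two strings anticommute at exactly one site, the mode of the smaller index, so the sign is
  -- attached there and the claim is checked site by site.
  have : ∀ P : Op n, -P = (∏ k : Fin n, if k = ⟨i / 2, hi⟩ then (-1 : ℂ) else 1) • P := by
    intro P; simp
  rw [this, ← tensorString_smul]
  congr 1
  funext k
  simp only [Fin.ext_iff]
  have hij : (i : ℕ) < j := h
  rcases lt_trichotomy (k : ℕ) (i / 2) with hk | hk | hk
  · have h1 : (k : ℕ) < j / 2 := by omega
    simp [hk, h1, hk.ne]
  · rcases lt_or_ge ((i : ℕ) / 2) ((j : ℕ) / 2) with h2 | h2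
    · simp only [hk, lt_irrefl, h2, if_true, if_false]
      split_ifs
      exacts [pauliX_mul_pauliZ, pauliY_mul_pauliZ]
    · have h3 : (j : ℕ) / 2 = i / 2 := by omega
      have h4 : (i : ℕ) % 2 = 0 := by omega
      have h5 : ¬ (j : ℕ) % 2 = 0 := by omega
      simp only [hk, h3, lt_irrefl, h4, h5, if_true, if_false]
      exact pauliX_mul_pauliY_eq_neg
  · simp [hk.ne', not_lt.2 hk.le]

theorem majorana_mul_of_ne {i j : Fin (2 * n)} (h : i ≠ j) :
    majorana i * majorana j = -(majorana j * majorana i : Op n) := by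
  rcases h.lt_or_gt with h | h
  · exact majorana_mul_of_lt h
  · rw [majorana_mul_of_lt h, neg_neg]

theorem trace_one_op : (1 : Op n).trace = 2 ^ n := by
  simp [Matrix.trace_one]

theorem trace_majorana_mul (i j : Fin (2 * n)) :
    (majorana i * majorana j : Op n).trace = if i = j then 2 ^ n else 0 := by
  split_ifs with h
  · rw [h, majorana_mul_self, trace_one_op]
  · have h1 := congrArg Matrix.trace (majorana_mul_of_ne h)
    rw [Matrix.trace_neg, Matrix.trace_mul_comm (majorana j)] at h1
    exact self_eq_neg.1 h1

theorem trace_majorana_mul_majoranaComb (i : Fin (2 * n)) (v : Fin (2 * n) → ℝ) :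
    (majorana i * majoranaComb v : Op n).trace = 2 ^ n * v i := by
  simp [majoranaComb, Matrix.mul_sum, Matrix.trace_sum, trace_majorana_mul, mul_comm]

theorem trace_majoranaComb_mul (v w : Fin (2 * n) → ℝ) :
    (majoranaComb v * majoranaComb w : Op n).trace = 2 ^ n * ((v ⬝ᵥ w : ℝ) : ℂ) := by
  conv_lhs => rw [majoranaComb]
  simp only [Matrix.sum_mul, Matrix.trace_sum, Matrix.smul_mul, Matrix.trace_smul,
    trace_majorana_mul_majoranaComb, dotProduct, smul_eq_mul, Complex.ofReal_sum,
    Complex.ofReal_mul, Finset.mul_sum]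
  exact Finset.sum_congr rfl fun i _ => by ring

end Majorana

/-! ### The embedding `u ↦ 1 ⊗ u` -/

section OnLastModes

variable {n s : ℕ}

/-- Splitting a string of `n` bits into the first `n - s` and the last `s` bits. -/
def splitBits (h : s ≤ n) :
    (Fin n → Fin 2) ≃ (Fin (n - s) → Fin 2) × (Fin s → Fin 2) :=
  (Equiv.arrowCongr (finSumFinEquiv.trans (finCongr (Nat.sub_add_cancel h))).symm
    (Equiv.refl _)).trans (Equiv.sumArrowEquivProdArrow _ _ _)

theorem splitBits_fst (h : s ≤ n) (x : Fin n → Fin 2) (i : Fin (n - s)) :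
    (splitBits h x).1 i = x ⟨i, by omega⟩ := rfl

theorem splitBits_snd (h : s ≤ n) (x : Fin n → Fin 2) : (splitBits h x).2 = lastBits h x := rfl

theorem onLastModes_eq_submatrix (h : s ≤ n) (u : Op s) :
    onLastModes h u = ((1 : Op (n - s)) ⊗ₖ u).submatrix (splitBits h) (splitBits h) := by
  ext x y
  change _ = (1 : Op (n - s)) (splitBits h x).1 (splitBits h y).1 *
    u (splitBits h x).2 (splitBits h y).2
  simp only [onLastModes, Matrix.of_apply, Matrix.one_apply, splitBits_snd, ite_mul, one_mul,
    zero_mul]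
  refine if_congr ?_ rfl rfl
  simp only [funext_iff, splitBits_fst]
  exact ⟨fun H i => H _ i.2, fun H i hi => H ⟨i, hi⟩⟩

/-- `onLastModes` as a homomorphism of star algebras. -/
def onLastModesHom (h : s ≤ n) : Op s →⋆ₐ[ℂ] Op n where
  toFun := onLastModes h
  map_one' := by
    rw [onLastModes_eq_submatrix, Matrix.one_kronecker_one, Matrix.submatrix_one_equiv]
  map_mul' u v := by
    simp only [onLastModes_eq_submatrix]
    rw [Matrix.submatrix_mul_equiv, ← Matrix.mul_kronecker_mul, one_mul]
  map_zero' := by rw [onLastModes_eq_submatrix, Matrix.kronecker_zero]; rfl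
  map_add' u v := by
    simp only [onLastModes_eq_submatrix, Matrix.kronecker_add]; rfl
  commutes' c := by
    rw [Algebra.algebraMap_eq_smul_one, Algebra.algebraMap_eq_smul_one, onLastModes_eq_submatrix,
      Matrix.kronecker_smul, Matrix.one_kronecker_one, Matrix.submatrix_smul]
    simp
  map_star' u := by
    simp only [onLastModes_eq_submatrix, Matrix.star_eq_conjTranspose,
      Matrix.conjTranspose_submatrix, Matrix.conjTranspose_kronecker, Matrix.conjTranspose_one]

theorem onLastModesHom_apply (h : s ≤ n) (u : Op s) : onLastModesHom h u = onLastModes h u := rfl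

theorem onLastModes_injective (h : s ≤ n) :
    Function.Injective (onLastModes h : Op s → Op n) := by
  intro u v huv
  rw [onLastModes_eq_submatrix, onLastModes_eq_submatrix] at huv
  ext z w
  have := congrFun₂ huv ((splitBits h).symm (0, z)) ((splitBits h).symm (0, w))
  simpa using this

theorem trace_onLastModes (h : s ≤ n) (u : Op s) :
    (onLastModes h u).trace = 2 ^ (n - s) * u.trace := by
  rw [onLastModes_eq_submatrix, ← trace_one_op, ← Matrix.trace_kronecker]
  exact Equiv.sum_comp (splitBits h) fun p => ((1 : Op (n - s)) ⊗ₖ u) p p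

end OnLastModes

/-! ### The commutant of the first Majoranas -/

section Commutant

variable {n : ℕ}

/-- The single-mode operator `P` on mode `a`. -/
def onMode (a : Fin n) (P : Matrix (Fin 2) (Fin 2) ℂ) : Op n :=
  tensorString fun i => if i = a then P else 1

theorem onMode_apply (a : Fin n) (P : Matrix (Fin 2) (Fin 2) ℂ) (x y : Fin n → Fin 2) :
    onMode a P x y = if y = Function.update x a (y a) then P (x a) (y a) else 0 := by
  simp only [onMode, tensorString, Matrix.of_apply]
  rw [← Finset.mul_prod_erase _ _ (Finset.mem_univ a), if_pos rfl]
  have h1 : ∀ i ∈ Finset.univ.erase a, (if i = a then P else 1) (x i) (y i) =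
      if x i = y i then 1 else 0 := by
    intro i hi
    rw [if_neg (Finset.ne_of_mem_erase hi), Matrix.one_apply]
  rw [Finset.prod_congr rfl h1, Finset.prod_ite_zero, Finset.prod_const_one, mul_ite, mul_one,
    mul_zero]
  have h2 : (∀ i ∈ Finset.univ.erase a, x i = y i) ↔ y = Function.update x a (y a) := by
    refine ⟨fun H => ?_, fun H i hi => ?_⟩
    · funext i
      by_cases hi : i = a
      · subst hi; simp
      · rw [Function.update_of_ne hi, H i (by simp [hi])]
    · rw [H, Function.update_of_ne (Finset.ne_of_mem_erase hi)]
  by_cases h3 : y = Function.update x a (y a)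
  · rw [if_pos h3, if_pos (h2.2 h3)]
  · rw [if_neg h3, if_neg fun h => h3 (h2.1 h)]

/-- The product of the operators `Z` on the modes below `a`. -/
def zString (a : ℕ) : Op n := tensorString fun i => if (i : ℕ) < a then pauliZ else 1

/-- This starts the inversion of the Jordan–Wigner transform: Majorana pairs give the `Z` on each
mode, these give the strings, and stripping the string from a Majorana gives the `X` on that mode.
-/
theorem majorana_even_mul_odd (a : Fin n) :
    majorana ⟨2 * a, by omega⟩ * majorana ⟨2 * a + 1, by omega⟩ = Complex.I • onMode a pauliZ := by
  have : ∀ P : Op n, Complex.I • P = (∏ k : Fin n, if k = a then Complex.I else 1) • P := by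
    intro P; simp
  rw [this, onMode, ← tensorString_smul, majorana, majorana, tensorString_mul]
  congr 1
  funext i
  have h1 : (2 * (a : ℕ)) / 2 = a := by omega
  have h2 : (2 * (a : ℕ) + 1) / 2 = a := by omega
  have h3 : (2 * (a : ℕ) + 1) % 2 = 1 := by omega
  simp only [h1, h2, h3, Fin.ext_iff]
  rcases lt_trichotomy (i : ℕ) a with h | h | h
  · simp [h, h.ne, pauliZ_mul_self]
  · simp [h, pauliX_mul_pauliY]
  · simp [h.ne', not_lt.2 h.le]

theorem zString_succ (a : Fin n) : (zString (a + 1) : Op n) = zString a * onMode a pauliZ := by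
  rw [zString, zString, onMode, tensorString_mul]
  congr 1
  funext i
  simp only [Fin.ext_iff]
  rcases lt_trichotomy (i : ℕ) a with h | h | h
  · simp [h, h.ne, h.trans (Nat.lt_succ_self _)]
  · simp [h]
  · have : ¬ (i : ℕ) < a + 1 := by omega
    simp [h.ne', not_lt.2 h.le, this]

theorem zString_mul_majorana (a : Fin n) :
    zString a * majorana ⟨2 * a, by omega⟩ = onMode a pauliX := by
  rw [zString, majorana, onMode, tensorString_mul]
  congr 1
  funext i
  have h1 : (2 * (a : ℕ)) / 2 = a := by omega
  simp only [h1, Fin.ext_iff]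
  rcases lt_trichotomy (i : ℕ) a with h | h | h
  · simp [h, h.ne, pauliZ_mul_self]
  · simp [h]
  · simp [h.ne', not_lt.2 h.le]

variable {D : Op n} {m : ℕ}

theorem commute_onMode_pauliZ (hD : ∀ j : Fin (2 * n), (j : ℕ) < 2 * m → Commute D (majorana j))
    (a : Fin n) (ha : (a : ℕ) < m) : Commute D (onMode a pauliZ) := by
  have h1 := (hD ⟨2 * a, by omega⟩ (by simp; omega)).mul_right
    (hD ⟨2 * a + 1, by omega⟩ (by simp; omega))
  rw [majorana_even_mul_odd] at h1
  have h2 := h1.smul_right (-Complex.I)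
  rwa [smul_smul, neg_mul, Complex.I_mul_I, neg_neg, one_smul] at h2

theorem commute_zString (hD : ∀ j : Fin (2 * n), (j : ℕ) < 2 * m → Commute D (majorana j))
    (hm : m ≤ n) (a : ℕ) (ha : a ≤ m) : Commute D (zString a) := by
  induction a with
  | zero => simp [zString, tensorString_one]
  | succ a ih =>
    have h := zString_succ (⟨a, by omega⟩ : Fin n)
    simp only at h
    rw [h]
    exact (ih (by omega)).mul_right (commute_onMode_pauliZ hD _ (by simpa using ha))

theorem commute_onMode_pauliX (hD : ∀ j : Fin (2 * n), (j : ℕ) < 2 * m → Commute D (majorana j))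
    (hm : m ≤ n) (a : Fin n) (ha : (a : ℕ) < m) : Commute D (onMode a pauliX) := by
  rw [← zString_mul_majorana]
  exact (commute_zString hD hm a ha.le).mul_right (hD _ (by simp; omega))

theorem apply_eq_zero_of_commute_onMode_pauliZ {a : Fin n} (h : Commute D (onMode a pauliZ))
    {x y : Fin n → Fin 2} (hxy : x a ≠ y a) : D x y = 0 := by
  have hdiag : onMode a pauliZ = Matrix.diagonal fun x => pauliZ (x a) (x a) := by
    ext x y
    rw [onMode_apply, Matrix.diagonal_apply]
    by_cases hxy : x = y
    · simp [hxy]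
    · rw [if_neg hxy]
      split_ifs with H
      · have : x a ≠ y a := fun e => hxy (by rw [H, ← e, Function.update_eq_self])
        generalize x a = p at *
        generalize y a = q at *
        fin_cases p <;> fin_cases q <;> simp_all [pauliZ]
      · rfl
  have h1 := congrFun₂ h.eq x y
  rw [hdiag, Matrix.mul_diagonal, Matrix.diagonal_mul] at h1
  generalize x a = p at *
  generalize y a = q at *
  fin_cases p <;> fin_cases q <;> simp_all [pauliZ, self_eq_neg, neg_eq_self]

/-- Multiplication by `X` on mode `a` flips bit `a` of the column or row index, so commuting makes
the entries invariant under flipping that bit in both. -/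
theorem apply_update_of_commute_onMode {a : Fin n} (hX : Commute D (onMode a pauliX))
    {x y : Fin n → Fin 2} (hxy : x a = y a) :
    D (Function.update x a 0) (Function.update y a 0) = D x y := by
  have hmulX : ∀ x y, (D * onMode a pauliX) x y = D x (Function.update y a (1 - y a)) := by
    intro x y
    rw [Matrix.mul_apply, Finset.sum_eq_single (Function.update y a (1 - y a))]
    · rw [onMode_apply, if_pos (by simp)]
      have : ∀ q : Fin 2, pauliX (1 - q) q = 1 := by
        intro q; fin_cases q <;> simp [pauliX]
      simp [this]
    · intro z _ hz
      rw [onMode_apply]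
      split_ifs with H
      · have : z a ≠ 1 - y a := by
          intro e
          apply hz
          rw [← e, H]; simp
        have h2 : ∀ p q : Fin 2, p ≠ 1 - q → pauliX p q = 0 := by
          intro p q; fin_cases p <;> fin_cases q <;> simp [pauliX]
        rw [h2 _ _ this, mul_zero]
      · rw [mul_zero]
    · simp
  have hXmul : ∀ x y, (onMode a pauliX * D) x y = D (Function.update x a (1 - x a)) y := by
    intro x y
    rw [Matrix.mul_apply, Finset.sum_eq_single (Function.update x a (1 - x a))]
    · rw [onMode_apply, if_pos (by simp)]
      have : ∀ q : Fin 2, pauliX q (1 - q) = 1 := by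
        intro q; fin_cases q <;> simp [pauliX]
      simp [this]
    · intro z _ hz
      rw [onMode_apply]
      split_ifs with H
      · have : z a ≠ 1 - x a := by
          intro e
          apply hz
          rw [H, ← e]
        have h2 : ∀ p q : Fin 2, q ≠ 1 - p → pauliX p q = 0 := by
          intro p q; fin_cases p <;> fin_cases q <;> simp [pauliX]
        rw [h2 _ _ this, zero_mul]
      · rw [zero_mul]
    · simp
  by_cases h0 : x a = 0
  · rw [← h0, Function.update_eq_self, hxy, Function.update_eq_self]
  · have h1 : ∀ q : Fin 2, q ≠ 0 → 1 - q = 0 := by decide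
    have h2 := congrFun₂ hX.eq x (Function.update y a 0)
    rw [hmulX, hXmul, h1 _ h0] at h2
    rw [← h2]
    have h3 : ∀ q : Fin 2, q ≠ 0 → 1 - 0 = q := by decide
    rw [Function.update_self, h3 (y a) (hxy ▸ h0), Function.update_idem, Function.update_eq_self]

/-- An operator that commutes with the Majorana operators of the first `n - s` modes acts on the
last `s` modes only. -/
theorem exists_eq_onLastModes {s : ℕ} (hs : s ≤ n)
    (hD : ∀ j : Fin (2 * n), (j : ℕ) < 2 * (n - s) → Commute D (majorana j)) :
    ∃ d : Op s, D = onLastModes hs d := by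
  -- `tr k` clears the first `k` bits. Where row and column agree on the first `n - s` bits, these
  -- can be cleared one at a time without changing the entry, so only the last bits matter.
  set tr : ℕ → (Fin n → Fin 2) → (Fin n → Fin 2) :=
    fun k x i => if (i : ℕ) < k then 0 else x i with htr
  have hDtr : ∀ k ≤ n - s, ∀ x y : Fin n → Fin 2, (∀ i : Fin n, (i : ℕ) < n - s → x i = y i) →
      D (tr k x) (tr k y) = D x y := by
    intro k hk x y hxy
    induction k with
    | zero => simp [htr]
    | succ k ih =>
      have hup : ∀ x, tr (k + 1) x = Function.update (tr k x) ⟨k, by omega⟩ 0 := by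
        intro x
        funext i
        simp only [htr, Function.update_apply, Fin.ext_iff]
        grind
      rw [hup, hup, apply_update_of_commute_onMode (commute_onMode_pauliX hD (by omega) _ (by
        simpa using hk)), ih (by omega)]
      simp only [htr]
      rw [hxy _ (by simpa using hk)]
  refine ⟨Matrix.of fun z w => D ((splitBits hs).symm (0, z)) ((splitBits hs).symm (0, w)), ?_⟩
  have hsp : ∀ x, (splitBits hs).symm (0, lastBits hs x) = tr (n - s) x := by
    intro x
    rw [Equiv.symm_apply_eq]
    refine Prod.ext ?_ ?_
    · funext i
      rw [splitBits_fst]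
      simp [htr]
    · rw [splitBits_snd]
      funext i
      simp [lastBits, htr]
  ext x y
  simp only [onLastModes, Matrix.of_apply, hsp]
  split_ifs with h
  · rw [hDtr _ le_rfl x y h]
  · push Not at h
    obtain ⟨i, hi, hne⟩ := h
    exact apply_eq_zero_of_commute_onMode_pauliZ (commute_onMode_pauliZ hD i hi) hne

end Commutant

/-! ### Averaging over Majorana conjugations -/

section Twirl

variable {n : ℕ}

/-- The square of the Frobenius norm. -/
def normSqF (X : Op n) : ℝ := (Xᴴ * X).trace.re

theorem normSqF_nonneg (X : Op n) : 0 ≤ normSqF X :=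
  (Complex.le_def.1 (Matrix.posSemidef_conjTranspose_mul_self X).trace_nonneg).1

theorem normSqF_smul (c : ℂ) (X : Op n) : normSqF (c • X) = ‖c‖ ^ 2 * normSqF X := by
  rw [normSqF, Matrix.conjTranspose_smul, Matrix.smul_mul, Matrix.mul_smul, smul_smul,
    Matrix.trace_smul, RCLike.star_def, ← Complex.normSq_eq_conj_mul_self, smul_eq_mul,
    Complex.re_ofReal_mul, Complex.normSq_eq_norm_sq, normSqF]

theorem normSqF_mul_right {g : Op n} (hg : g * gᴴ = 1) (X : Op n) :
    normSqF (X * g) = normSqF X := by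
  rw [normSqF, Matrix.conjTranspose_mul, Matrix.trace_mul_comm, Matrix.mul_assoc,
    ← Matrix.mul_assoc g, hg, Matrix.one_mul, Matrix.trace_mul_comm, normSqF]

theorem normSqF_onLastModes {s : ℕ} (hs : s ≤ n) (d : Op s) :
    normSqF (onLastModes hs d) = 2 ^ (n - s) * normSqF d := by
  have h : (onLastModes hs d)ᴴ * onLastModes hs d = onLastModes hs (dᴴ * d) := by
    simp only [← onLastModesHom_apply, map_mul, ← Matrix.star_eq_conjTranspose, map_star]
  have h2 : (2 : ℂ) ^ (n - s) = ((2 ^ (n - s) : ℝ) : ℂ) := by push_cast; rfl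
  rw [normSqF, h, trace_onLastModes, h2, Complex.re_ofReal_mul, normSqF]

theorem normSqF_add_of_trace_eq_zero {P Q : Op n} (h : (Pᴴ * Q).trace = 0) :
    normSqF (P + Q) = normSqF P + normSqF Q := by
  have h2 : (Qᴴ * P).trace = 0 := by
    rw [← Matrix.conjTranspose_conjTranspose P, ← Matrix.conjTranspose_mul,
      Matrix.trace_conjTranspose, h, star_zero]
  simp only [normSqF, Matrix.conjTranspose_add, Matrix.add_mul, Matrix.mul_add, Matrix.trace_add,
    h, h2, add_zero, zero_add, Complex.add_re]

variable {g : Op n}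

/-- Conjugation by `g` preserves the trace, negates the odd part and fixes the even part; their
inner product therefore equals its own negative. -/
theorem normSqF_odd_add_even (hg : gᴴ = g) (hgg : g * g = 1) (A B : Op n) :
    normSqF ((2⁻¹ : ℂ) • (A - g * A * g) + (2⁻¹ : ℂ) • (B + g * B * g)) =
      normSqF ((2⁻¹ : ℂ) • (A - g * A * g)) + normSqF ((2⁻¹ : ℂ) • (B + g * B * g)) := by
  apply normSqF_add_of_trace_eq_zero
  have h : ((A - g * A * g)ᴴ * (B + g * B * g)).trace = 0 := by
    have h1 : (A - g * A * g)ᴴ = -(g * (A - g * A * g)ᴴ * g) := by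
      simp only [Matrix.conjTranspose_sub, Matrix.conjTranspose_mul, hg, Matrix.mul_sub,
        Matrix.sub_mul]
      have : g * (g * (Aᴴ * g)) * g = Aᴴ := by
        rw [← mul_assoc, hgg, one_mul, mul_assoc, hgg, mul_one]
      rw [this]
      simp only [mul_assoc, neg_sub]
    have h2 : B + g * B * g = g * (B + g * B * g) * g := by
      have : g * (g * B * g) * g = B := by
        rw [mul_assoc g B g, ← mul_assoc, hgg, one_mul, mul_assoc, hgg, mul_one]
      rw [Matrix.mul_add, Matrix.add_mul, this, add_comm]
    have h3 : ((A - g * A * g)ᴴ * (B + g * B * g)).trace =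
        -((A - g * A * g)ᴴ * (B + g * B * g)).trace := by
      conv_lhs => rw [h1, Matrix.neg_mul, Matrix.trace_neg, Matrix.mul_assoc, Matrix.mul_assoc,
        Matrix.trace_mul_comm, Matrix.mul_assoc]
      conv_rhs => rw [h2]
    exact self_eq_neg.1 h3
  rw [Matrix.conjTranspose_smul, Matrix.smul_mul, Matrix.mul_smul, Matrix.trace_smul,
    Matrix.trace_smul, h, smul_zero, smul_zero]

theorem normSqF_even_le (hg : gᴴ = g) (hgg : g * g = 1) (B : Op n) :
    normSqF ((2⁻¹ : ℂ) • (B + g * B * g)) ≤ normSqF B := by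
  have h := normSqF_odd_add_even hg hgg B B
  have h1 : (2⁻¹ : ℂ) • (B - g * B * g) + (2⁻¹ : ℂ) • (B + g * B * g) = B := by module
  rw [h1] at h
  have := normSqF_nonneg ((2⁻¹ : ℂ) • (B - g * B * g))
  linarith

theorem normSqF_odd (hg : gᴴ = g) (hgg : g * g = 1) (A : Op n) :
    normSqF ((2⁻¹ : ℂ) • (A - g * A * g)) = normSqF (A * g - g * A) / 4 := by
  have h1 : (A - g * A * g) = (A * g - g * A) * g := by
    rw [Matrix.sub_mul, mul_assoc A, hgg, mul_one]
  rw [normSqF_smul, h1, normSqF_mul_right (by rw [hg, hgg])]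
  norm_num
  ring

/-- An operator is close in Frobenius norm to the commutant of a set of Majorana operators with
which it nearly commutes. -/
theorem exists_commute_majorana_normSqF_sub_le (X : Op n) (S : Finset (Fin (2 * n))) :
    ∃ Y : Op n, (∀ j ∈ S, Commute Y (majorana j)) ∧
      normSqF (X - Y) ≤ ∑ j ∈ S, normSqF (X * majorana j - majorana j * X) / 4 := by
  induction S using Finset.induction_on with
  | empty => exact ⟨X, by simp, by simp [normSqF]⟩
  | insert j S hj ih =>
    obtain ⟨Y, hY, hXY⟩ := ih
    have hg := majorana_conjTranspose j
    have hgg := majorana_mul_self j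
    generalize hgdef : (majorana j : Op n) = g at *
    refine ⟨(2⁻¹ : ℂ) • (Y + g * Y * g), fun k hk => ?_, ?_⟩
    · refine Commute.smul_left ?_ _
      rcases Finset.mem_insert.1 hk with rfl | hk
      · rw [hgdef, Commute, SemiconjBy, add_mul, mul_add, mul_assoc (g * Y), hgg, mul_one, mul_assoc g Y,
          ← mul_assoc g g, hgg, one_mul, add_comm]
      · have hYk := hY k hk
        have hne : k ≠ j := fun e => hj (e ▸ hk)
        have ha := majorana_mul_of_ne hne
        rw [hgdef] at ha
        -- Moving `majorana k` through `g Y g` crosses `g` twice, so the two signs cancel and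
        -- averaging over `g` keeps the commutation relations already obtained.
        refine hYk.add_left ?_
        rw [Commute, SemiconjBy]
        calc g * Y * g * majorana k = g * Y * (g * majorana k) := by rw [mul_assoc]
          _ = -(g * (Y * majorana k) * g) := by
            rw [← neg_eq_iff_eq_neg.2 ha]; simp only [mul_neg, mul_assoc]
          _ = -(g * majorana k * Y * g) := by rw [hYk.eq]; simp only [mul_assoc]
          _ = majorana k * (g * Y * g) := by
            rw [← neg_eq_iff_eq_neg.2 ha]; simp only [neg_mul, neg_neg, mul_assoc]
    · rw [Finset.sum_insert hj, hgdef, ← normSqF_odd hg hgg]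
      -- The new error is the odd part of `X` plus the even part of the old error. By Pythagoras the
      -- squared errors add, rather than the norms.
      have h1 : X - (2⁻¹ : ℂ) • (Y + g * Y * g) =
          (2⁻¹ : ℂ) • (X - g * X * g) + (2⁻¹ : ℂ) • ((X - Y) + g * (X - Y) * g) := by
        rw [Matrix.mul_sub, Matrix.sub_mul]
        module
      rw [h1, normSqF_odd_add_even hg hgg]
      have := normSqF_even_le hg hgg (X - Y)
      linarith

theorem normSqF_commutator {W : Op n} (hW : Wᴴ * W = 1) (hg : gᴴ = g)
    (hgg : g * g = 1) :
    normSqF (W * g - g * W) = 2 * (2 ^ n - (g * (W * g * Wᴴ)).trace.re) := by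
  have h1 : (W * g - g * W)ᴴ * (W * g - g * W) =
      1 - (g * Wᴴ) * (g * W) - (Wᴴ * g) * (W * g) + 1 := by
    have e1 : g * Wᴴ * (W * g) = 1 := by
      rw [mul_assoc, ← mul_assoc Wᴴ, hW, one_mul, hgg]
    have e2 : Wᴴ * g * (g * W) = 1 := by
      rw [mul_assoc, ← mul_assoc g, hgg, one_mul, hW]
    simp only [Matrix.conjTranspose_sub, Matrix.conjTranspose_mul, hg, Matrix.sub_mul,
      Matrix.mul_sub, e1, e2]
    abel
  have h2 : ((Wᴴ * g) * (W * g)).trace = (g * (W * g * Wᴴ)).trace := by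
    rw [Matrix.mul_assoc, Matrix.trace_mul_comm, Matrix.mul_assoc]
  have h3 : ((g * Wᴴ) * (g * W)).trace = star (g * (W * g * Wᴴ)).trace := by
    rw [← h2, ← Matrix.trace_conjTranspose]
    simp only [Matrix.conjTranspose_mul, hg, Matrix.conjTranspose_conjTranspose]
  rw [normSqF, h1, Matrix.trace_add, Matrix.trace_sub, Matrix.trace_sub, h2, h3, trace_one_op]
  have h4 : ((2 : ℂ) ^ n).re = 2 ^ n := by
    have : (2 : ℂ) ^ n = ((2 ^ n : ℝ) : ℂ) := by push_cast; rfl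
    rw [this, Complex.ofReal_re]
  simp only [Complex.add_re, Complex.sub_re, h4, RCLike.star_def, Complex.conj_re]
  ring

theorem eq_zero_of_normSqF_eq_zero {X : Op n} (h : normSqF X = 0) : X = 0 := by
  have h1 := sq_norm_le_trace X
  change _ ≤ normSqF X at h1
  rw [h] at h1
  exact norm_eq_zero.1 (pow_eq_zero_iff two_ne_zero |>.1 (le_antisymm h1 (sq_nonneg _)))

end Twirl

/-! ### Singular values forced to equal one -/

section SingularValues

/-- If a contraction with decreasing singular values `s` preserves the norm of `k` orthonormal
vectors, then its first `k` singular values are `1`. -/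
theorem singular_value_eq_one_of_isometric {N k : ℕ} {A B : Matrix (Fin N) (Fin N) ℝ}
    (hA : A ∈ Matrix.orthogonalGroup (Fin N) ℝ) (hB : B ∈ Matrix.orthogonalGroup (Fin N) ℝ)
    {s : Fin N → ℝ} (hs : Antitone s) (hs0 : ∀ i, 0 ≤ s i) (hs1 : ∀ i, s i ≤ 1)
    {v w : Fin k → Fin N → ℝ} (hv : ∀ a b, v a ⬝ᵥ v b = if a = b then 1 else 0)
    (hw : ∀ a, w a ⬝ᵥ w a = 1) (hvw : ∀ a, (A * Matrix.diagonal s * Bᵀ) *ᵥ v a = w a)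
    (i : Fin N) (hi : (i : ℕ) < k) : s i = 1 := by
  have hA' : Aᵀ * A = 1 := (Matrix.mem_orthogonalGroup_iff' _ _).1 hA
  have hB' : B * Bᵀ = 1 := (Matrix.mem_orthogonalGroup_iff _ _).1 hB
  have hdot : ∀ (C : Matrix (Fin N) (Fin N) ℝ) (_ : Cᵀ * C = 1) (x y : Fin N → ℝ),
      (C *ᵥ x) ⬝ᵥ (C *ᵥ y) = x ⬝ᵥ y := by
    intro C hC x y
    rw [Matrix.dotProduct_mulVec, ← Matrix.mulVec_transpose, Matrix.mulVec_mulVec, hC,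
      Matrix.one_mulVec]
  set x : Fin k → Fin N → ℝ := fun a => Bᵀ *ᵥ v a with hx
  have hxx : ∀ a b, x a ⬝ᵥ x b = if a = b then 1 else 0 := by
    intro a b
    rw [← hv a b]
    exact hdot Bᵀ (by rwa [Matrix.transpose_transpose]) _ _
  have hsx : ∀ a, ∑ j, (1 - s j ^ 2) * x a j ^ 2 = 0 := by
    intro a
    have h1 : (Matrix.diagonal s *ᵥ x a) ⬝ᵥ (Matrix.diagonal s *ᵥ x a) = 1 := by
      rw [← hdot A hA', ← hw a, ← hvw a]
      simp only [hx, Matrix.mulVec_mulVec, Matrix.mul_assoc]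
    have h2 := hxx a a
    rw [if_pos rfl] at h2
    have h3 := h2.trans h1.symm
    simp only [dotProduct, Matrix.mulVec_diagonal] at h3
    rw [← sub_eq_zero, ← Finset.sum_sub_distrib] at h3
    rw [← h3]
    exact Finset.sum_congr rfl fun j _ => by ring
  by_contra hne
  have hlt : s i < 1 := lt_of_le_of_ne (hs1 i) hne
  -- If `s i < 1`, monotonicity makes every later weight `1 - s j ^ 2` positive, so all the `x a`
  -- are supported on the first `i` coordinates. That would be `k` orthonormal vectors in dimension
  -- `i < k`, which the rank of `X` excludes.
  have hx0 : ∀ a j, i ≤ j → x a j = 0 := by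
    intro a j hij
    have h1 : ∀ j ∈ Finset.univ, 0 ≤ (1 - s j ^ 2) * x a j ^ 2 := fun j _ =>
      mul_nonneg (by nlinarith [hs0 j, hs1 j]) (sq_nonneg _)
    have h2 := (Finset.sum_eq_zero_iff_of_nonneg h1).1 (hsx a) j (Finset.mem_univ j)
    have h3 : 1 - s j ^ 2 ≠ 0 := by
      have := hs hij
      have := hs0 j
      nlinarith
    simpa [h3] using h2
  set X : Matrix (Fin k) (Fin i) ℝ := Matrix.of fun a j => x a ⟨j, j.2.trans i.2⟩ with hX
  have hXX : X * Xᵀ = 1 := by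
    ext a b
    rw [Matrix.one_apply, ← hxx a b, Matrix.mul_apply, dotProduct]
    refine Finset.sum_of_injOn (fun j : Fin i => (⟨j, j.2.trans i.2⟩ : Fin N)) ?_ ?_ ?_ ?_
    · intro j _ l _ h
      simpa [Fin.ext_iff] using h
    · simp
    · intro j _ hj
      rw [hx0 a j, zero_mul]
      by_contra hlt
      exact hj ⟨⟨j, not_le.1 hlt⟩, by simp, rfl⟩
    · intro j _
      rfl
  have h1 := Matrix.rank_mul_le_left X Xᵀ
  rw [hXX, Matrix.rank_one, Fintype.card_fin] at h1
  have h2 := X.rank_le_width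
  omega

end SingularValues

/-! ### The correlation matrix as a compression of conjugation by `U` -/

section Correlation

variable {n : ℕ}

theorem trace_majoranaComb_mul_conj (U : Op n) (v w : Fin (2 * n) → ℝ) :
    (majoranaComb v * (U * majoranaComb w * Uᴴ)).trace =
      2 ^ n * ((v ⬝ᵥ (correlationMatrix U *ᵥ w) : ℝ) : ℂ) := by
  have h : ∀ a b, (majorana a * (U * majorana b * Uᴴ)).trace =
      2 ^ n * ((correlationMatrix U a b : ℝ) : ℂ) := by
    intro a b
    rw [correlationMatrix_ofReal]
    field_simp
  simp only [majoranaComb, Matrix.sum_mul, Matrix.smul_mul, Matrix.mul_smul,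
    Matrix.trace_sum, Matrix.trace_smul, h, dotProduct, Matrix.mulVec, smul_eq_mul,
    Complex.ofReal_sum, Complex.ofReal_mul, Finset.mul_sum, Finset.smul_sum]
  rw [Finset.sum_comm]
  exact Finset.sum_congr rfl fun a _ => Finset.sum_congr rfl fun b _ => by ring

/-- The matrix records conjugation by `U` followed by projection onto the span of the Majoranas; the
projection loses nothing when the image already lies there. -/
theorem correlationMatrix_mulVec_of_conj_eq {U : Op n} {v w : Fin (2 * n) → ℝ}
    (h : U * majoranaComb v * Uᴴ = majoranaComb w) : correlationMatrix U *ᵥ v = w := by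
  refine dotProduct_eq _ _ fun e => ?_
  have h1 := trace_majoranaComb_mul_conj U e v
  rw [h, trace_majoranaComb_mul] at h1
  have h2 := mul_left_cancel₀ (by positivity) h1
  rw [dotProduct_comm, dotProduct_comm w]
  exact_mod_cast h2.symm

theorem trace_majorana_mul_conj_of_svd {U G_A G_B : Op n}
    {V_A V_B : Matrix (Fin (2 * n)) (Fin (2 * n)) ℝ} {s : Fin (2 * n) → ℝ}
    (hA : IsGaussianUnitaryOf G_A V_A) (hB : IsGaussianUnitaryOf G_B V_B)
    (hsvd : correlationMatrix U = V_A * Matrix.diagonal s * V_Bᵀ) (a : Fin (2 * n)) :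
    (majorana a * ((G_Aᴴ * U * G_B) * majorana a * (G_Aᴴ * U * G_B)ᴴ)).trace =
      ((2 ^ n * s a : ℝ) : ℂ) := by
  have h1 : (majorana a * ((G_Aᴴ * U * G_B) * majorana a * (G_Aᴴ * U * G_B)ᴴ)).trace =
      ((G_A * majorana a * G_Aᴴ) * (U * (G_B * majorana a * G_Bᴴ) * Uᴴ)).trace := by
    simp only [Matrix.conjTranspose_mul, Matrix.conjTranspose_conjTranspose, Matrix.mul_assoc]
    rw [Matrix.trace_mul_comm G_A]
    simp only [Matrix.mul_assoc]
  rw [h1, hA.2.2, hB.2.2, trace_majoranaComb_mul_conj]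
  have h2 : (fun b => V_A b a) ⬝ᵥ (correlationMatrix U *ᵥ fun b => V_B b a) =
      (V_Aᵀ * correlationMatrix U * V_B) a a := by
    rw [Matrix.mul_assoc]
    rfl
  have h3 : V_Aᵀ * correlationMatrix U * V_B = Matrix.diagonal s := by
    have e1 : V_Aᵀ * V_A = 1 := (Matrix.mem_orthogonalGroup_iff' _ _).1 hA.2.1
    have e2 : V_Bᵀ * V_B = 1 := (Matrix.mem_orthogonalGroup_iff' _ _).1 hB.2.1
    rw [hsvd]
    simp only [Matrix.mul_assoc]
    rw [e2, Matrix.mul_one, ← Matrix.mul_assoc, e1, Matrix.one_mul]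
  rw [h2, h3, Matrix.diagonal_apply_eq]
  push_cast
  rfl

end Correlation

/-! ### From the commutant to a unitary on few modes -/

section Approximation

variable {n : ℕ}

theorem exists_mem_unitaryGroup_of_commute {s : ℕ} (hs : s ≤ n) {Q : Op n}
    (hQ : Q ∈ Matrix.unitaryGroup (Fin n → Fin 2) ℂ)
    (hcomm : ∀ j : Fin (2 * n), (j : ℕ) < 2 * (n - s) → Commute Q (majorana j)) :
    ∃ u ∈ Matrix.unitaryGroup (Fin s → Fin 2) ℂ, Q = onLastModes hs u := by
  obtain ⟨u, rfl⟩ := exists_eq_onLastModes hs hcomm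
  refine ⟨u, Matrix.mem_unitaryGroup_iff.2 (onLastModes_injective hs ?_), rfl⟩
  simp only [← onLastModesHom_apply, map_mul, map_star, map_one]
  exact Matrix.mem_unitaryGroup_iff.1 hQ

/-- With `D = 1 ⊗ d`, the squared Frobenius norm of `D` is `2^(n-s)` times that of `d`, while the
operator norm of `D` is at most that of `d`. -/
theorem norm_le_of_normSqF_le {s : ℕ} (hs : s ≤ n) {D : Op n}
    (hcomm : ∀ j : Fin (2 * n), (j : ℕ) < 2 * (n - s) → Commute D (majorana j)) {r : ℝ}
    (hr : 0 ≤ r) (hD : normSqF D ≤ 2 ^ (n - s) * r ^ 2) : ‖D‖ ≤ r := by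
  obtain ⟨d, rfl⟩ := exists_eq_onLastModes hs hcomm
  rw [normSqF_onLastModes, mul_le_mul_iff_right₀ (by positivity)] at hD
  have h1 : ‖onLastModes hs d‖ ≤ ‖d‖ := norm_starAlgHom_matrix_le (onLastModesHom hs) d
  exact h1.trans (le_of_sq_le_sq ((sq_norm_le_trace d).trans hD) hr)

/-- A unitary at distance at most `r` from an operator that commutes with some of the Majorana
operators is at distance at most `2 r` from a unitary that commutes with them. -/
theorem exists_unitary_commute_norm_sub_le {W Y : Op n} {r : ℝ}
    (hW : W ∈ Matrix.unitaryGroup (Fin n → Fin 2) ℂ) (hWY : ‖W - Y‖ ≤ r) :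
    ∃ Q ∈ Matrix.unitaryGroup (Fin n → Fin 2) ℂ, ‖W - Q‖ ≤ 2 * r ∧
      ∀ j : Fin (2 * n), Commute Y (majorana j) → Commute Q (majorana j) := by
  rcases lt_or_ge r 1 with hr | hr
  · obtain ⟨Q, hQ, h1, h2⟩ := exists_unitary_norm_sub_le (x := Y) hW (by rwa [norm_sub_rev]) hr
    refine ⟨Q, hQ, ?_, fun j hj => h2 _ hj ?_⟩
    · calc ‖W - Q‖ ≤ ‖W - Y‖ + ‖Y - Q‖ := norm_sub_le_norm_sub_add_norm_sub _ _ _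
        _ ≤ 2 * r := by linarith
    · have h3 : star (majorana j : Op n) = majorana j := majorana_conjTranspose j
      rw [← h3]
      exact hj.star_star
  · refine ⟨1, one_mem _, ?_, fun j _ => Commute.one_left _⟩
    have h1 := norm_le_one_of_mem_unitaryGroup hW
    have h2 := norm_le_one_of_mem_unitaryGroup
      (one_mem (Matrix.unitaryGroup (Fin n → Fin 2) ℂ))
    linarith [norm_sub_le W 1]

end Approximation

/-! ### Counting the Majoranas that contribute -/

section Counting

theorem card_filter_fin_le {N : ℕ} (a b : ℕ) :
    (Finset.univ.filter fun j : Fin N => a ≤ (j : ℕ) ∧ (j : ℕ) < b).card ≤ b - a := by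
  rw [← Nat.card_Ico]
  refine Finset.card_le_card_of_injOn (fun j : Fin N => (j : ℕ)) ?_ ?_
  · intro j hj
    simpa using hj
  · intro i _ j _ h
    exact Fin.ext h

theorem sum_filter_lt_le {N : ℕ} {f : Fin N → ℝ} {a b : ℕ} {c : ℝ} (hc : 0 ≤ c)
    (h0 : ∀ j : Fin N, (j : ℕ) < a → f j = 0) (h1 : ∀ j : Fin N, (j : ℕ) < b → f j ≤ c) :
    ∑ j ∈ Finset.univ.filter (fun j : Fin N => (j : ℕ) < b), f j ≤ ((b - a : ℕ) : ℝ) * c := by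
  have h2 : ∑ j ∈ Finset.univ.filter (fun j : Fin N => (j : ℕ) < b), f j =
      ∑ j ∈ Finset.univ.filter (fun j : Fin N => a ≤ (j : ℕ) ∧ (j : ℕ) < b), f j := by
    symm
    refine Finset.sum_subset (fun j hj => ?_) fun j hj hj' => h0 j ?_
    · simp only [Finset.mem_filter_univ] at hj ⊢; exact hj.2
    · simp only [Finset.mem_filter_univ] at hj hj'; omega
  rw [h2]
  refine (Finset.sum_le_card_nsmul _ f c fun j hj => h1 j (Finset.mem_filter.1 hj).2.2).trans ?_
  rw [nsmul_eq_mul]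
  gcongr
  exact card_filter_fin_le a b

end Counting

end Fermion

end

/-! ### The main theorem -/

theorem mainTheorem6 (n t t' : ℕ) (ht : t ≤ n) (ht' : t' ≤ t) (ε : ℝ) (hε : 0 ≤ ε)
    (U G_A G_B : Fermion.Op n)
    (hU : U ∈ Matrix.unitaryGroup (Fin n → Fin 2) ℂ)
    (hdim : Fermion.GaussianDimensionAtLeast U (2 * (n - t)))
    (V_A V_B : Matrix (Fin (2 * n)) (Fin (2 * n)) ℝ)
    (hA : Fermion.IsGaussianUnitaryOf G_A V_A)
    (hB : Fermion.IsGaussianUnitaryOf G_B V_B)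
    (hsvd : Fermion.correlationMatrix U =
      V_A * Matrix.diagonal (fun i : Fin (2 * n) =>
        Fermion.singularValue (Fermion.correlationMatrix U) i) * V_Bᵀ)
    (hσ : t' < n → 1 - ε ^ 2 / (16 * (t : ℝ) * 2 ^ t) ≤
      Fermion.singularValue (Fermion.correlationMatrix U) (2 * n - 2 * t' - 1)) :
    ∃ (U' : Fermion.Op n) (u' : Fermion.Op t'),
      U' ∈ Matrix.unitaryGroup (Fin n → Fin 2) ℂ ∧
      u' ∈ Matrix.unitaryGroup (Fin t' → Fin 2) ℂ ∧
      U' = G_A * Fermion.onLastModes (ht'.trans ht) u' * G_Bᴴ ∧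
      Fermion.diamondDistance U U' ≤ ENNReal.ofReal ε := by
  open Fermion Matrix.Norms.L2Operator in
  have hanti : Antitone (singularValue (correlationMatrix U)) :=
    (Matrix.toEuclideanLin (correlationMatrix U)).singularValues_antitone
  have hnonneg : ∀ k, 0 ≤ singularValue (correlationMatrix U) k :=
    (Matrix.toEuclideanLin (correlationMatrix U)).singularValues_nonneg
  generalize singularValue (correlationMatrix U) = σ at *
  have hAu := hA.1
  have hBu := hB.1
  have hAA : G_A * G_Aᴴ = 1 := Matrix.mem_unitaryGroup_iff.1 hAu
  have hBB : G_B * G_Bᴴ = 1 := Matrix.mem_unitaryGroup_iff.1 hBu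
  set W : Op n := G_Aᴴ * U * G_B with hWdef
  have hW : W ∈ Matrix.unitaryGroup (Fin n → Fin 2) ℂ :=
    mul_mem (mul_mem (Unitary.star_mem hAu) hU) hBu
  have hcomm : ∀ j : Fin (2 * n),
      normSqF (W * majorana j - majorana j * W) = 2 * 2 ^ n * (1 - σ j) := by
    intro j
    rw [normSqF_commutator (Matrix.mem_unitaryGroup_iff'.1 hW) (majorana_conjTranspose j)
      (majorana_mul_self j), trace_majorana_mul_conj_of_svd hA hB hsvd, Complex.ofReal_re]
    ring
  have hσ1 : ∀ j : Fin (2 * n), σ j ≤ 1 := by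
    intro j
    have h1 := normSqF_nonneg (W * majorana j - majorana j * W)
    rw [hcomm] at h1
    have := nonneg_of_mul_nonneg_right h1 (by positivity)
    linarith
  have hσeq : ∀ j : Fin (2 * n), (j : ℕ) < 2 * (n - t) → σ j = 1 := by
    obtain ⟨v, w, hv, hv', hw, hvw⟩ := hdim
    refine singular_value_eq_one_of_isometric hA.2.1 hB.2.1 (s := fun i => σ i)
      (fun i j hij => hanti hij) (fun i => hnonneg i) hσ1 (v := v) (w := w) (fun a b => ?_)
      (fun a => ?_) (fun a => ?_)
    · split_ifs with hab
      · subst hab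
        rw [← hv a]
        exact Finset.sum_congr rfl fun i _ => (sq _).symm
      · have h1 := hv' a b hab
        rw [trace_majoranaComb_mul] at h1
        simpa using h1
    · rw [← hw a]
      exact Finset.sum_congr rfl fun i _ => (sq _).symm
    · rw [← hsvd]
      exact correlationMatrix_mulVec_of_conj_eq (hvw a)
  have hWcomm : ∀ j : Fin (2 * n), (j : ℕ) < 2 * (n - t) → Commute W (majorana j) := by
    intro j hj
    have h1 := hcomm j
    rw [hσeq j hj, sub_self, mul_zero] at h1
    exact sub_eq_zero.1 (eq_zero_of_normSqF_eq_zero h1)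
  obtain ⟨Y, hY, hWY⟩ := exists_commute_majorana_normSqF_sub_le W
    (Finset.univ.filter fun j : Fin (2 * n) => (j : ℕ) < 2 * (n - t'))
  have hY' : ∀ j : Fin (2 * n), (j : ℕ) < 2 * (n - t') → Commute Y (majorana j) :=
    fun j hj => hY j (by simpa using hj)
  have hnorm : ‖W - Y‖ ≤ ε / 4 := by
    refine norm_le_of_normSqF_le ht (fun j hj => (hWcomm j hj).sub_left (hY' j (by omega)))
      (by positivity) (hWY.trans ?_)
    have h1 := sum_filter_lt_le (N := 2 * n)
      (f := fun j => normSqF (W * majorana j - majorana j * W) / 4)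
      (a := 2 * (n - t)) (b := 2 * (n - t'))
      (c := 2 ^ n * (ε ^ 2 / (16 * (t : ℝ) * 2 ^ t)) / 2) (by positivity)
      (fun j hj => by rw [hcomm, hσeq j hj]; ring) (fun j hj => by
        -- An index `j < 2(n-t')` exists only if `t' < n`, so the hypothesis on the singular values
        -- is available exactly where it is needed.
        have h2 := hσ (by omega)
        have h3 := hanti (show (j : ℕ) ≤ 2 * n - 2 * t' - 1 by omega)
        have h4 : 1 - σ j ≤ ε ^ 2 / (16 * (t : ℝ) * 2 ^ t) := by linarith
        rw [hcomm]
        have h5 := mul_le_mul_of_nonneg_left h4 (show (0 : ℝ) ≤ 2 ^ n by positivity)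
        linarith)
    refine h1.trans ?_
    have h2 : 2 * (n - t') - 2 * (n - t) = 2 * (t - t') := by omega
    have h3 : (2 : ℝ) ^ n = 2 ^ (n - t) * 2 ^ t := by rw [← pow_add, Nat.sub_add_cancel ht]
    rw [h2, h3]
    -- For `t = 0` no index contributes and the division by zero is harmless. Otherwise at most `2t`
    -- indices contribute `2^n · ε²/(16 t 2^t) / 2` each, which totals `2^(n-t) (ε/4)²`.
    rcases Nat.eq_zero_or_pos t with rfl | htpos
    · simp; positivity
    · have h4 : ((2 * (t - t') : ℕ) : ℝ) ≤ 2 * t := by exact_mod_cast (by omega)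
      have h5 : (0 : ℝ) < t := by exact_mod_cast htpos
      calc _ ≤ 2 * (t : ℝ) * (2 ^ (n - t) * 2 ^ t * (ε ^ 2 / (16 * (t : ℝ) * 2 ^ t)) / 2) := by
            gcongr
        _ = _ := by field_simp; norm_num
  obtain ⟨Q, hQ, hWQ, hQY⟩ := exists_unitary_commute_norm_sub_le hW hnorm
  obtain ⟨u', hu', hQu⟩ := exists_mem_unitaryGroup_of_commute (ht'.trans ht) hQ
    fun j hj => hQY j (hY' j hj)
  have hU' : G_A * Q * G_Bᴴ ∈ Matrix.unitaryGroup (Fin n → Fin 2) ℂ :=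
    mul_mem (mul_mem hAu hQ) (Unitary.star_mem hBu)
  refine ⟨G_A * Q * G_Bᴴ, u', hU', hu', by rw [hQu], ?_⟩
  refine (diamondDistance_le hU hU').trans (ENNReal.ofReal_le_ofReal ?_)
  have hUW : U - G_A * Q * G_Bᴴ = G_A * (W - Q) * G_Bᴴ := by
    have : U = G_A * W * G_Bᴴ := by
      rw [hWdef]
      simp only [Matrix.mul_assoc]
      rw [hBB, Matrix.mul_one, ← Matrix.mul_assoc, hAA, Matrix.one_mul]
    rw [Matrix.mul_sub, Matrix.sub_mul, ← this]
  have h1 := norm_le_one_of_mem_unitaryGroup hAu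
  have h2 : ‖G_Bᴴ‖ ≤ 1 := norm_le_one_of_mem_unitaryGroup (Unitary.star_mem hBu)
  have h3 : ‖G_A * (W - Q) * G_Bᴴ‖ ≤ 1 * ‖W - Q‖ * 1 :=
    norm_mul₃_le.trans (by gcongr)
  rw [hUW]
  linarith
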